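/- Let $N$ (subcarriers), $M$ (OFDM symbols), $N_T$ (transmit antennas), $N_U$ (receive antennas) be natural numbers and $\sigma_C>0$. For the two carriers $b\in\{1,2\}$ let $X_n^b\in\mathbb C^{N_T\times M}$ be the random transmit data and $\tilde H_n^b\in\mathbb C^{N_T\times N_U}$ the random channel on subcarrier $n\in\{0,\dots,N-1\}$, and put $$X_C^b=\mathrm{diag}\big((X_0^b)^T,\dots,(X_{N-1}^b)^T\big)\in\mathbb C^{NM\times NN_T},\quad H_C^b=\begin{bmatrix}\tilde H_0^b\\ \vdots\\ \tilde H_{N-1}^b\end{bmatrix}\in\mathbb C^{NN_T\times N_U},\quad H^b=\mathrm{diag}\big(\tilde H_0^b,\dots,\tilde H_{N-1}^b\big)\in\mathbb C^{NN_T\times NN_U}.$$ The received signal is $Y=\sum_{b=1}^2 X_C^bH_C^b+W\in\mathbb C^{NM\times N_U}$, where the entries of $W$ are i.i.d. $\mathcal{CN}(0,\sigma_C^2)$ (circularly symmetric) and $W$ is independent of all data and channels jointly. Assume that, given the channels $(H_C^1,H_C^2)$, the row vectors of the matrices $(X_n^b)^T$ (one for each carrier $b$, subcarrier $n$ and symbol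 time $m$) are independent, zero-mean, circularly symmetric complex Gaussian, possibly degenerate, with a covariance that does not depend on $m$. Then, for almost every realization of the known channels, the matrix in the determinant below is Hermitian positive definite and the mutual information (in bits) given that realization, that is, the Kullback-Leibler divergence of the conditional joint law of $((X_C^1,X_C^2),Y)$ from the product of its marginals, is finite and equals $$I(X_C^1,X_C^2;Y\mid H_C^1,H_C^2)=M\log_2\Big[(\sigma_C^2)^{-N_UN}\det\Big(\sum_{b=1}^2 (H^b)^H\,E\Big[\tfrac{(X_C^b)^HX_C^b}{M}\Big]H^b+\sigma_C^2I_{N_UN}\Big)\Big],$$ where $E$ is the expectation given the channels. Consequently the conditional mutual information averaged over the channels is the expectation of the right-hand side over the channels. If the data are independent of the channels, both statements hold with $E$ the ordinary expectation. -/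

import Mathlib

open MeasureTheory ProbabilityTheory
open scoped ENNReal Matrix ComplexOrder

noncomputable section

/-- Matrices carry the product (entrywise) measurable structure. -/
instance matrixMeasurableSpace {m n : Type*} : MeasurableSpace (Matrix m n ℂ) :=
  inferInstanceAs (MeasurableSpace (m → n → ℂ))

/-- Complex matrices of countable size form a standard Borel space. -/
instance matrixStandardBorelSpace {m n : Type*} [Countable m] [Countable n] :
    StandardBorelSpace (Matrix m n ℂ) :=
  inferInstanceAs (StandardBorelSpace (m → n → ℂ))

/-- Mutual information, in bits, of the two coordinates of a pair with joint law `ρ`: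
the Kullback-Leibler divergence of `ρ` from the product of its marginals. -/
def mutualInfo {α β : Type*} [MeasurableSpace α] [MeasurableSpace β]
    (ρ : Measure (α × β)) : ℝ≥0∞ :=
  InformationTheory.klDiv ρ (ρ.fst.prod ρ.snd) / ENNReal.ofReal (Real.log 2)

/-- `I(A; B | Z = z)`, in bits: mutual information under the conditional law of `(A, B)`
given `Z = z`. -/
def condMutualInfoAt {Ω α β γ : Type*} [MeasurableSpace Ω]
    [MeasurableSpace α] [StandardBorelSpace α] [Nonempty α]
    [MeasurableSpace β] [StandardBorelSpace β] [Nonempty β] [MeasurableSpace γ]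
    (P : Measure Ω) [IsFiniteMeasure P] (A : Ω → α) (B : Ω → β) (Z : Ω → γ) (z : γ) : ℝ≥0∞ :=
  mutualInfo (condDistrib (fun ω => (A ω, B ω)) Z P z)

/-- `I(A; B | Z)`, in bits: the average of `I(A; B | Z = z)` over the law of `Z`. -/
def condMutualInfo {Ω α β γ : Type*} [MeasurableSpace Ω]
    [MeasurableSpace α] [StandardBorelSpace α] [Nonempty α]
    [MeasurableSpace β] [StandardBorelSpace β] [Nonempty β] [MeasurableSpace γ]
    (P : Measure Ω) [IsFiniteMeasure P] (A : Ω → α) (B : Ω → β) (Z : Ω → γ) : ℝ≥0∞ :=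
  ∫⁻ z, condMutualInfoAt P A B Z z ∂(P.map Z)

/-- `μ` is the circularly symmetric complex Gaussian law `CN(0, K)` of a random row vector `x`:
real and imaginary parts jointly Gaussian, zero mean, covariance `E[xᴴ x] = K`,
pseudo-covariance `E[xᵀ x] = 0`. The covariance may be singular. -/
structure IsComplexGaussian {ι : Type*} [Fintype ι]
    (μ : Measure (ι → ℂ)) (K : Matrix ι ι ℂ) : Prop where
  isGaussian : IsGaussian μ
  mean_eq : ∀ i, ∫ x, x i ∂μ = 0
  cov_eq : ∀ i j, ∫ x, star (x i) * x j ∂μ = K i j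
  pseudoCov_eq : ∀ i j, ∫ x, x i * x j ∂μ = 0

/-- The transmit data of one carrier: on each of the `N` subcarriers, an `NT × M` matrix
(transmit antennas by symbol times). -/
abbrev CarrierData (N M NT : ℕ) : Type := Fin N → Matrix (Fin NT) (Fin M) ℂ

/-- The channel of one carrier: on each of the `N` subcarriers, an `NT × NU` matrix
(transmit antennas by receive antennas). -/
abbrev CarrierChannel (N NT NU : ℕ) : Type := Fin N → Matrix (Fin NT) (Fin NU) ℂ

/-- `X_C = diag(X_0ᵀ, …, X_{N-1}ᵀ)`, of size `MN × NT N`. -/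
def dataMatrix {N M NT : ℕ} (x : CarrierData N M NT) :
    Matrix (Fin M × Fin N) (Fin NT × Fin N) ℂ :=
  Matrix.blockDiagonal fun n => (x n)ᵀ

/-- `H_C`: the subcarrier channels stacked on top of each other, of size `NT N × NU`. -/
def stackedChannel {N NT NU : ℕ} (h : CarrierChannel N NT NU) :
    Matrix (Fin NT × Fin N) (Fin NU) ℂ :=
  Matrix.of fun kn z => h kn.2 kn.1 z

/-- `H = diag(H_0, …, H_{N-1})`, of size `NT N × NU N`. -/
def diagChannel {N NT NU : ℕ} (h : CarrierChannel N NT NU) :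
    Matrix (Fin NT × Fin N) (Fin NU × Fin N) ℂ :=
  Matrix.blockDiagonal h

/-- The received signal `Y = ∑_b X_C^b H_C^b + W`, of size `MN × NU`. -/
def received {N M NT NU : ℕ} (x : Fin 2 → CarrierData N M NT)
    (h : Fin 2 → CarrierChannel N NT NU) (w : Matrix (Fin M × Fin N) (Fin NU) ℂ) :
    Matrix (Fin M × Fin N) (Fin NU) ℂ :=
  (∑ b, dataMatrix (x b) * stackedChannel (h b)) + w

/-- The data law of the two carriers is Gaussian signalling: the row vectors transmitted on
the different carriers `b`, subcarriers `n` and symbol times `m` are independent, and the one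
for `(b, n, m)` is `CN(0, K b n)`, the covariance not depending on `m`. -/
def IsGaussianSignalling {N M NT : ℕ} (ν : Measure (Fin 2 → CarrierData N M NT)) : Prop :=
  iIndepFun (fun (p : Fin 2 × Fin N × Fin M) (x : Fin 2 → CarrierData N M NT) (k : Fin NT) =>
      x p.1 p.2.1 k p.2.2) ν ∧
    ∃ K : Fin 2 → Fin N → Matrix (Fin NT) (Fin NT) ℂ, ∀ (b : Fin 2) (n : Fin N) (m : Fin M),
      IsComplexGaussian (ν.map fun x (k : Fin NT) => x b n k m) (K b n)

/-- `E[(X_C^b)ᴴ X_C^b / M]` when the data have law `ν`, the expectation being entrywise. -/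
def inputCov {N M NT : ℕ} (ν : Measure (Fin 2 → CarrierData N M NT)) (b : Fin 2) :
    Matrix (Fin NT × Fin N) (Fin NT × Fin N) ℂ :=
  Matrix.of fun i j => ∫ x, ((dataMatrix (x b))ᴴ * dataMatrix (x b)) i j / (M : ℂ) ∂ν

/-- `∑_b (H^b)ᴴ E[(X_C^b)ᴴ X_C^b / M] H^b + σ² I` for channel `h` and data law `ν`. -/
def outputCov {N M NT NU : ℕ} (σ : ℝ) (ν : Measure (Fin 2 → CarrierData N M NT))
    (h : Fin 2 → CarrierChannel N NT NU) : Matrix (Fin NU × Fin N) (Fin NU × Fin N) ℂ :=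
  (∑ b, (diagChannel (h b))ᴴ * inputCov ν b * diagChannel (h b)) + ((σ ^ 2 : ℝ) : ℂ) • 1

/-- `M log₂ [(σ²)^{-NU N} det(∑_b (H^b)ᴴ E[(X_C^b)ᴴ X_C^b / M] H^b + σ² I)]`.
The real part only casts the determinant of a Hermitian matrix from `ℂ` to `ℝ`. -/
def closedFormMI {N M NT NU : ℕ} (σ : ℝ) (ν : Measure (Fin 2 → CarrierData N M NT))
    (h : Fin 2 → CarrierChannel N NT NU) : ℝ :=
  M * Real.logb 2 ((σ ^ 2) ^ (-((NU * N : ℕ) : ℤ)) * (outputCov σ ν h).det.re)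

end

/-!
Given the channel, the received signal is `g(U) + W`, where `U` is the data, `g` is linear, and the
noise `W` is independent of `U`. Both `W` and `g(U) + W` are circularly symmetric complex Gaussian,
with covariances `σ² I` and `S = C + σ² I`, where `C` is the covariance of `g(U)`. Writing
`S = Bᴴ B` and `A = σ⁻¹ B`, the output has the same law as `W A`, because a complex Gaussian law is
determined by its covariance (`IsComplexGaussian.ext`).

For additive noise with density `p`, the joint law of input and output has density
`p (y - g u)` and the output has density `p (y A⁻¹) / |det A|²`, the exponent `2` coming from `A`
acting on a real space of twice the dimension. Hence the log-likelihood ratio at `(u, y)` is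
`log p (y - g u) - log p (y A⁻¹) + log |det A|²`. Both `y - g u` and `y A⁻¹` have the law of the
noise, so the first two terms cancel in expectation and the mutual information is
`log |det A|² = log (det S / det (σ² I))` (`klDiv_additive_noise`, `mutualInfo_gaussian_channel`).
Only the existence of a density with integrable logarithm is used
(`IsComplexGaussian.exists_density`); no Gaussian entropy is computed. The covariance of the data
may be singular, since the input law itself never needs a density.

The rows sent at different times and on different subcarriers are independent, so `S` is block
diagonal, with one block for each time and subcarrier that does not depend on the time. The blocks
of one symbol time form the matrix `outputCov`, whence `det S = (det outputCov) ^ M`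
(`det_receivedCov`) and the factor `M` of the closed form (`mutualInfo_received`).

Independence of the noise from data and channel identifies the conditional law of
(data, received signal) given `H = h` as the law of the pair built from the conditional law of the
data and an independent noise (`condDistrib_noise_ae_eq`), to which the fixed-channel result applies.
-/

/-! ### Circularly symmetric complex Gaussian laws -/

lemma star_sum_mul_sum {ι : Type*} [Fintype ι] (x a b : ι → ℂ) :
    star (∑ i, x i * a i) * ∑ j, x j * b j
      = ∑ i, ∑ j, star (x i) * x j * (star (a i) * b j) := by
  rw [star_sum, Finset.sum_mul_sum]
  refine Finset.sum_congr rfl fun i _ => Finset.sum_congr rfl fun j _ => ?_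
  rw [star_mul']; ring

lemma sum_mul_sum_eq_sum_mul_mul {ι : Type*} [Fintype ι] (x a b : ι → ℂ) :
    (∑ i, x i * a i) * ∑ j, x j * b j = ∑ i, ∑ j, x i * x j * (a i * b j) := by
  rw [Finset.sum_mul_sum]
  refine Finset.sum_congr rfl fun i _ => Finset.sum_congr rfl fun j _ => ?_
  ring

lemma integral_add_add_add {Ω : Type*} [MeasurableSpace Ω] {P : Measure Ω} {f₁ f₂ f₃ f₄ : Ω → ℂ}
    (h₁ : Integrable f₁ P) (h₂ : Integrable f₂ P) (h₃ : Integrable f₃ P) (h₄ : Integrable f₄ P) :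
    ∫ x, (f₁ x + f₂ x) + (f₃ x + f₄ x) ∂P =
      (∫ x, f₁ x ∂P + ∫ x, f₂ x ∂P) + (∫ x, f₃ x ∂P + ∫ x, f₄ x ∂P) := by
  rw [← integral_add h₁ h₂, ← integral_add h₃ h₄]
  exact integral_add (h₁.add h₂) (h₃.add h₄)

/-- Every real-linear functional on `ℂ^ι` is the real part of a complex-linear one. -/
lemma StrongDual.exists_eq_re_sum {ι : Type*} [Fintype ι] (L : StrongDual ℝ (ι → ℂ)) :
    ∃ a : ι → ℂ, ∀ x, L x = (∑ i, x i * a i).re := by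
  classical
  refine ⟨fun i => L (Pi.single i 1) - L (Pi.single i Complex.I) * Complex.I, fun x => ?_⟩
  have hx : x = ∑ i, ((x i).re • (Pi.single i (1 : ℂ) : ι → ℂ)
      + (x i).im • (Pi.single i Complex.I : ι → ℂ)) := by
    ext j
    simp [Finset.sum_apply, Pi.single_apply, Finset.sum_add_distrib, Complex.re_add_im]
  conv_lhs => rw [hx]
  simp only [map_sum, map_add, map_smul, Complex.re_sum]
  refine Finset.sum_congr rfl fun i _ => ?_
  simp

namespace IsComplexGaussian

variable {ι κ : Type*} [Fintype ι] [Fintype κ] {μ ν : Measure (ι → ℂ)} {K K' : Matrix ι ι ℂ}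

lemma memLp_eval (h : IsComplexGaussian μ K) (i : ι) : MemLp (fun x : ι → ℂ => x i) 2 μ := by
  have := h.isGaussian
  exact (IsGaussian.memLp_two_id (μ := μ)).eval i

lemma integrable_eval (h : IsComplexGaussian μ K) (i : ι) :
    Integrable (fun x : ι → ℂ => x i) μ := by
  have := h.isGaussian
  exact (h.memLp_eval i).integrable (by norm_num)

lemma integrable_star_mul (h : IsComplexGaussian μ K) (i j : ι) :
    Integrable (fun x : ι → ℂ => star (x i) * x j) μ :=
  (h.memLp_eval i).star.integrable_mul (h.memLp_eval j)

lemma integrable_mul (h : IsComplexGaussian μ K) (i j : ι) :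
    Integrable (fun x : ι → ℂ => x i * x j) μ :=
  (h.memLp_eval i).integrable_mul (h.memLp_eval j)

lemma integral_linear (h : IsComplexGaussian μ K) (a : ι → ℂ) :
    ∫ x, ∑ i, x i * a i ∂μ = 0 := by
  rw [integral_finsetSum _ fun i _ => (h.integrable_eval i).mul_const _]
  simp [integral_mul_const, h.mean_eq]

lemma integral_star_linear_mul_linear (h : IsComplexGaussian μ K) (a b : ι → ℂ) :
    ∫ x, star (∑ i, x i * a i) * ∑ j, x j * b j ∂μ
      = ∑ i, ∑ j, K i j * (star (a i) * b j) := by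
  simp_rw [star_sum_mul_sum]
  rw [integral_finsetSum _ fun i _ => integrable_finsetSum _ fun j _ =>
    (h.integrable_star_mul i j).mul_const _]
  refine Finset.sum_congr rfl fun i _ => ?_
  rw [integral_finsetSum _ fun j _ => (h.integrable_star_mul i j).mul_const _]
  simp only [integral_mul_const, h.cov_eq]

lemma integral_linear_mul_linear (h : IsComplexGaussian μ K) (a b : ι → ℂ) :
    ∫ x, (∑ i, x i * a i) * ∑ j, x j * b j ∂μ = 0 := by
  simp_rw [sum_mul_sum_eq_sum_mul_mul]
  rw [integral_finsetSum _ fun i _ => integrable_finsetSum _ fun j _ =>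
    (h.integrable_mul i j).mul_const _]
  refine Finset.sum_eq_zero fun i _ => ?_
  rw [integral_finsetSum _ fun j _ => (h.integrable_mul i j).mul_const _]
  simp only [integral_mul_const, h.pseudoCov_eq, zero_mul, Finset.sum_const_zero]

lemma integrable_linear (h : IsComplexGaussian μ K) (a : ι → ℂ) :
    Integrable (fun x : ι → ℂ => ∑ i, x i * a i) μ :=
  integrable_finsetSum _ fun i _ => (h.integrable_eval i).mul_const _

lemma integrable_star_linear_mul_linear (h : IsComplexGaussian μ K) (a b : ι → ℂ) :
    Integrable (fun x : ι → ℂ => star (∑ i, x i * a i) * ∑ j, x j * b j) μ := by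
  simp_rw [star_sum_mul_sum]
  exact integrable_finsetSum _ fun i _ => integrable_finsetSum _ fun j _ =>
    (h.integrable_star_mul i j).mul_const _

lemma integrable_linear_mul_linear (h : IsComplexGaussian μ K) (a b : ι → ℂ) :
    Integrable (fun x : ι → ℂ => (∑ i, x i * a i) * ∑ j, x j * b j) μ := by
  simp_rw [sum_mul_sum_eq_sum_mul_mul]
  exact integrable_finsetSum _ fun i _ => integrable_finsetSum _ fun j _ =>
    (h.integrable_mul i j).mul_const _

/-- Since `a* K a = E|∑ i, x i * a i|²`. -/
lemma posSemidef (h : IsComplexGaussian μ K) : K.PosSemidef := by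
  refine Matrix.posSemidef_iff_dotProduct_mulVec.mpr ⟨?_, fun a => ?_⟩
  · ext i j
    rw [Matrix.conjTranspose_apply, ← h.cov_eq, ← h.cov_eq]
    change (starRingEnd ℂ) _ = _
    rw [← integral_conj]
    refine integral_congr_ae (.of_forall fun x => ?_)
    simp [mul_comm]
  · have := h.integral_star_linear_mul_linear a a
    have e : star a ⬝ᵥ K *ᵥ a = ∑ i, ∑ j, K i j * (star (a i) * a j) := by
      simp only [dotProduct, Matrix.mulVec, Finset.mul_sum, Pi.star_apply]
      refine Finset.sum_congr rfl fun i _ => Finset.sum_congr rfl fun j _ => ?_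
      ring
    rw [e, ← this]
    have : ∀ x : ι → ℂ, star (∑ i, x i * a i) * ∑ j, x j * a j
        = ((Complex.normSq (∑ i, x i * a i) : ℝ) : ℂ) := fun x => by
      rw [Complex.normSq_eq_conj_mul_self]; rfl
    simp_rw [this]
    rw [integral_complex_ofReal]
    exact_mod_cast integral_nonneg fun x => Complex.normSq_nonneg _

/-- `(Re z)² = Re (|z|² + z²) / 2`, and the pseudo-covariance term vanishes. -/
lemma integral_re_sq (h : IsComplexGaussian μ K) (a : ι → ℂ) :
    ∫ x, (∑ i, x i * a i).re ^ 2 ∂μ = (∑ i, ∑ j, K i j * (star (a i) * a j)).re / 2 := by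
  have e : ∀ z : ℂ, z.re ^ 2 = ((star z * z) + z * z).re / 2 := fun z => by
    simp; ring
  simp_rw [e]
  rw [integral_div]
  have hi := (h.integrable_star_linear_mul_linear a a).add (h.integrable_linear_mul_linear a a)
  have := integral_re hi
  simp only [RCLike.re_to_complex, Pi.add_apply] at this
  rw [this, integral_add (h.integrable_star_linear_mul_linear a a)
    (h.integrable_linear_mul_linear a a), h.integral_star_linear_mul_linear,
    h.integral_linear_mul_linear, add_zero]

/-- A circularly symmetric complex Gaussian law is determined by its covariance matrix: a real
functional is `Re ⟨a, x⟩`, and circular symmetry makes its variance half of `E|⟨a, x⟩|²`. -/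
theorem ext (h : IsComplexGaussian μ K) (h' : IsComplexGaussian ν K) : μ = ν := by
  have := h.isGaussian
  have := h'.isGaussian
  refine Measure.ext_of_charFunDual (funext fun L => ?_)
  obtain ⟨a, ha⟩ := StrongDual.exists_eq_re_sum L
  have mean : ∀ {ξ : Measure (ι → ℂ)}, IsComplexGaussian ξ K → ξ[L] = 0 := fun {ξ} hξ => by
    have := integral_re (hξ.integrable_linear a)
    simp only [RCLike.re_to_complex] at this
    simp_rw [ha]
    rw [this, hξ.integral_linear]; simp
  have var : ∀ {ξ : Measure (ι → ℂ)}, IsComplexGaussian ξ K →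
      Var[L; ξ] = (∑ i, ∑ j, K i j * (star (a i) * a j)).re / 2 := fun {ξ} hξ => by
    rw [variance_of_integral_eq_zero (by fun_prop) (mean hξ), ← hξ.integral_re_sq]
    simp_rw [ha]
  rw [IsGaussian.charFunDual_eq, IsGaussian.charFunDual_eq, var h, var h',
    integral_complex_ofReal, integral_complex_ofReal, mean h, mean h']

lemma map_vecMul (h : IsComplexGaussian μ K) (A : Matrix ι κ ℂ) :
    IsComplexGaussian (μ.map fun x => x ᵥ* A) (Aᴴ * K * A) := by
  have := h.isGaussian
  have hA : Continuous fun x : ι → ℂ => x ᵥ* A := by fun_prop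
  let L : (ι → ℂ) →L[ℝ] (κ → ℂ) := ⟨(Matrix.vecMulLinear A).restrictScalars ℝ, hA⟩
  have hm : AEMeasurable (fun x : ι → ℂ => x ᵥ* A) μ := hA.aemeasurable
  have hev : ∀ x j, (x ᵥ* A) j = ∑ i, x i * A i j := fun x j => rfl
  refine ⟨inferInstanceAs (IsGaussian (μ.map L)), fun i => ?_, fun i j => ?_, fun i j => ?_⟩
  · rw [integral_map hm (measurable_pi_apply i).aestronglyMeasurable]
    simp_rw [hev]
    exact h.integral_linear _
  · rw [integral_map hm (by fun_prop)]
    simp_rw [hev]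
    rw [h.integral_star_linear_mul_linear]
    simp only [Matrix.mul_apply, Matrix.conjTranspose_apply, Finset.sum_mul]
    rw [Finset.sum_comm]
    refine Finset.sum_congr rfl fun i _ => Finset.sum_congr rfl fun j _ => ?_
    ring
  · rw [integral_map hm (by fun_prop)]
    simp_rw [hev]
    exact h.integral_linear_mul_linear _ _

/-- The sum of independent complex Gaussian vectors is complex Gaussian, and covariances add. -/
lemma map_add_prod (h : IsComplexGaussian μ K) (h' : IsComplexGaussian ν K') :
    IsComplexGaussian ((μ.prod ν).map fun z => z.1 + z.2) (K + K') := by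
  have := h.isGaussian
  have := h'.isGaussian
  have hm : AEMeasurable (fun z : (ι → ℂ) × (ι → ℂ) => z.1 + z.2) (μ.prod ν) := by fun_prop
  have m1 : ∀ i, MemLp (fun z : (ι → ℂ) × (ι → ℂ) => z.1 i) 2 (μ.prod ν) := fun i =>
    MemLp.comp_fst (f := fun x : ι → ℂ => x i) (h.memLp_eval i) ν
  have m2 : ∀ i, MemLp (fun z : (ι → ℂ) × (ι → ℂ) => z.2 i) 2 (μ.prod ν) := fun i =>
    MemLp.comp_snd (f := fun x : ι → ℂ => x i) (h'.memLp_eval i) μ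
  have i1 := fun i => (m1 i).integrable (by norm_num)
  have i2 := fun i => (m2 i).integrable (by norm_num)
  have e1 : ∀ f : (ι → ℂ) → ℂ, ∫ z, f z.1 ∂(μ.prod ν) = ∫ x, f x ∂μ := fun f => by
    simp [integral_fun_fst]
  have e2 : ∀ f : (ι → ℂ) → ℂ, ∫ z, f z.2 ∂(μ.prod ν) = ∫ x, f x ∂ν := fun f => by
    simp [integral_fun_snd]
  have c : ∀ f g : (ι → ℂ) → ℂ,
      ∫ z, f z.1 * g z.2 ∂(μ.prod ν) = (∫ x, f x ∂μ) * ∫ y, g y ∂ν := fun f g =>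
    integral_prod_mul f g
  refine ⟨inferInstanceAs (IsGaussian (μ.conv ν)), fun i => ?_, fun i j => ?_, fun i j => ?_⟩
  · rw [integral_map hm (measurable_pi_apply i).aestronglyMeasurable]
    simp only [Pi.add_apply]
    rw [integral_add (i1 i) (i2 i), e1 (fun x => x i), e2 (fun x => x i), h.mean_eq, h'.mean_eq,
      add_zero]
  · rw [integral_map hm (by fun_prop)]
    have : ∀ z : (ι → ℂ) × (ι → ℂ), star ((z.1 + z.2) i) * (z.1 + z.2) j
        = (star (z.1 i) * z.1 j + star (z.1 i) * z.2 j) +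
          (z.1 j * star (z.2 i) + star (z.2 i) * z.2 j) := fun z => by
      simp only [Pi.add_apply, star_add]; ring
    simp_rw [this]
    refine (integral_add_add_add ((m1 i).star.integrable_mul (m1 j))
      ((m1 i).star.integrable_mul (m2 j)) ((m1 j).integrable_mul (m2 i).star)
      ((m2 i).star.integrable_mul (m2 j))).trans ?_
    simp only [Pi.mul_apply, Pi.star_apply]
    rw [c (fun x => star (x i)) (fun y => y j), c (fun x => x j) (fun y => star (y i)),
      e1 (fun x => star (x i) * x j), e2 (fun x => star (x i) * x j), h.cov_eq, h'.cov_eq,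
      h.mean_eq, h'.mean_eq]
    simp
  · rw [integral_map hm (by fun_prop)]
    have : ∀ z : (ι → ℂ) × (ι → ℂ), (z.1 + z.2) i * (z.1 + z.2) j
        = (z.1 i * z.1 j + z.1 i * z.2 j) + (z.1 j * z.2 i + z.2 i * z.2 j) := fun z => by
      simp only [Pi.add_apply]; ring
    simp_rw [this]
    refine (integral_add_add_add ((m1 i).integrable_mul (m1 j)) ((m1 i).integrable_mul (m2 j))
      ((m1 j).integrable_mul (m2 i)) ((m2 i).integrable_mul (m2 j))).trans ?_
    simp only [Pi.mul_apply]
    rw [c (fun x => x i) (fun y => y j), c (fun x => x j) (fun y => y i),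
      e1 (fun x => x i * x j), e2 (fun x => x i * x j), h.pseudoCov_eq, h'.pseudoCov_eq,
      h.mean_eq, h.mean_eq]
    simp

/-- Independent complex Gaussian vectors are jointly complex Gaussian, with block-diagonal
covariance. -/
lemma of_iIndepFun {Ω : Type*} [MeasurableSpace Ω] {P : Measure Ω} [DecidableEq ι]
    {X : ι → Ω → κ → ℂ} (hX : ∀ i, Measurable (X i)) (hind : iIndepFun X P)
    {C : ι → Matrix κ κ ℂ} (h : ∀ i, IsComplexGaussian (P.map (X i)) (C i)) :
    IsComplexGaussian (P.map fun ω (p : κ × ι) => X p.2 ω p.1) (Matrix.blockDiagonal C) := by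
  have hP := hind.isProbabilityMeasure
  have hm : Measurable fun ω (p : κ × ι) => X p.2 ω p.1 :=
    measurable_pi_lambda _ fun p => (measurable_pi_apply _).comp (hX _)
  have hmi : ∀ (p : κ × ι), Measurable fun ω => X p.2 ω p.1 := fun p =>
    (measurable_pi_apply _).comp (hX _)
  have tr : ∀ (i : ι) (f : (κ → ℂ) → ℂ), Continuous f →
      ∫ ω, f (X i ω) ∂P = ∫ x, f x ∂(P.map (X i)) := fun i f hf =>
    (integral_map (hX i).aemeasurable hf.aestronglyMeasurable).symm
  have hmean : ∀ p : κ × ι, ∫ ω, X p.2 ω p.1 ∂P = 0 := fun p =>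
    (tr p.2 (fun x => x p.1) (by fun_prop)).trans ((h p.2).mean_eq p.1)
  have hpair : ∀ (p q : κ × ι), p.2 ≠ q.2 → ∀ f g : (κ → ℂ) → ℂ, Continuous f → Continuous g →
      ∫ ω, f (X p.2 ω) * g (X q.2 ω) ∂P = (∫ ω, f (X p.2 ω) ∂P) * ∫ ω, g (X q.2 ω) ∂P :=
    fun p q hpq f g hf hg =>
      ((hind.indepFun hpq).comp hf.measurable hg.measurable).integral_fun_mul_eq_mul_integral
        (hf.measurable.comp (hX _)).aestronglyMeasurable
        (hg.measurable.comp (hX _)).aestronglyMeasurable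
  refine ⟨?_, fun p => ?_, fun p q => ?_, fun p q => ?_⟩
  · have hG := hind.hasGaussianLaw fun i =>
      ⟨(h i).isGaussian⟩
    have hc : Continuous fun (x : ι → κ → ℂ) (p : κ × ι) => x p.2 p.1 := by fun_prop
    let L : (ι → κ → ℂ) →L[ℝ] (κ × ι → ℂ) :=
      ⟨{ toFun := fun x p => x p.2 p.1, map_add' := fun _ _ => rfl, map_smul' := fun _ _ => rfl },
        hc⟩
    exact (hG.map L).isGaussian_map
  · rw [integral_map hm.aemeasurable (measurable_pi_apply p).aestronglyMeasurable]
    exact hmean p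
  · rw [integral_map hm.aemeasurable (by fun_prop), Matrix.blockDiagonal_apply]
    obtain ⟨k, i⟩ := p
    obtain ⟨l, j⟩ := q
    split_ifs with hij
    · obtain rfl : i = j := hij
      exact (tr i (fun x => star (x k) * x l) (by fun_prop)).trans ((h i).cov_eq k l)
    · rw [hpair (k, i) (l, j) hij (fun x => star (x k)) (fun x => x l) (by fun_prop) (by fun_prop),
        hmean (l, j), mul_zero]
  · rw [integral_map hm.aemeasurable (by fun_prop)]
    obtain ⟨k, i⟩ := p
    obtain ⟨l, j⟩ := q
    by_cases hij : i = j
    · obtain rfl : i = j := hij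
      exact (tr i (fun x => x k * x l) (by fun_prop)).trans ((h i).pseudoCov_eq k l)
    · rw [hpair (k, i) (l, j) hij (fun x => x k) (fun x => x l) (by fun_prop) (by fun_prop),
        hmean (l, j), mul_zero]

end IsComplexGaussian

/-! ### Mutual information of additive noise channels -/

/-- The data processing inequality, applied in both directions. -/
lemma klDiv_map_measurableEquiv {α β : Type*} [MeasurableSpace α] [MeasurableSpace β]
    (μ ν : Measure α) [IsFiniteMeasure μ] [IsFiniteMeasure ν] (e : α ≃ᵐ β) :
    InformationTheory.klDiv (μ.map e) (ν.map e) = InformationTheory.klDiv μ ν := by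
  refine le_antisymm (InformationTheory.klDiv_map_le _ _ e.measurable) ?_
  have := InformationTheory.klDiv_map_le (μ.map e) (ν.map e) e.symm.measurable
  simpa [MeasurableEquiv.map_symm_map] using this

lemma mutualInfo_map_right {α β γ : Type*} [MeasurableSpace α] [MeasurableSpace β]
    [MeasurableSpace γ] (ρ : Measure (α × β)) [IsFiniteMeasure ρ] (e : β ≃ᵐ γ) :
    mutualInfo (ρ.map fun z => (z.1, e z.2)) = mutualInfo ρ := by
  let E : α × β ≃ᵐ α × γ := (MeasurableEquiv.refl α).prodCongr e
  have hE : ρ.map (fun z => (z.1, e z.2)) = ρ.map E := rfl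
  have h1 : (ρ.map E).fst = ρ.fst := by
    rw [Measure.fst, Measure.map_map measurable_fst E.measurable]; rfl
  have h2 : (ρ.map E).snd = ρ.snd.map e := by
    rw [Measure.snd, Measure.snd, Measure.map_map measurable_snd E.measurable,
      Measure.map_map e.measurable measurable_snd]; rfl
  have h3 : ρ.fst.prod (ρ.snd.map e) = (ρ.fst.prod ρ.snd).map E := by
    conv_lhs => rw [← Measure.map_id (μ := ρ.fst)]
    rw [Measure.map_prod_map _ _ measurable_id e.measurable]; rfl
  rw [mutualInfo, mutualInfo, hE, h1, h2, h3, klDiv_map_measurableEquiv]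

section AdditiveNoise

open InformationTheory

variable {U E : Type*} [MeasurableSpace U] [NormedAddCommGroup E] [NormedSpace ℝ E]
  [FiniteDimensional ℝ E] [MeasurableSpace E] [BorelSpace E]

lemma map_withDensity_continuousLinearEquiv (lam : Measure E) [lam.IsAddHaarMeasure]
    {p : E → ℝ≥0∞} (hp : Measurable p) (L : E ≃L[ℝ] E) :
    (lam.withDensity p).map L = lam.withDensity
      (fun y => ENNReal.ofReal |(LinearMap.det (L : E →ₗ[ℝ] E))⁻¹| * p (L.symm y)) := by
  have hdet : LinearMap.det (L : E →ₗ[ℝ] E) ≠ 0 := L.toLinearEquiv.isUnit_det'.ne_zero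
  refine Measure.ext_of_lintegral _ fun f hf => ?_
  have hps : Measurable fun y => p (L.symm y) := hp.comp L.symm.continuous.measurable
  have key := Measure.map_linearMap_addHaar_eq_smul_addHaar lam hdet
  rw [lintegral_map hf L.continuous.measurable,
    lintegral_withDensity_eq_lintegral_mul _ hp
      (show Measurable fun a => f (L a) from hf.comp L.continuous.measurable),
    lintegral_withDensity_eq_lintegral_mul _ (hps.const_mul _) hf]
  simp only [Pi.mul_apply, mul_assoc]
  have hpf : Measurable fun y => p (L.symm y) * f y := hps.mul hf
  rw [lintegral_const_mul _ hpf, ← smul_eq_mul, ← lintegral_smul_measure, ← key,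
    lintegral_map hpf (by exact L.continuous.measurable)]
  simp

/-- Joint law of the input `u` and the output `g u + w` of a channel whose additive noise `w` has
density `p`. -/
lemma map_shear_withDensity (α : Measure U) [SFinite α] (lam : Measure E) [lam.IsAddHaarMeasure]
    {p : E → ℝ≥0∞} (hp : Measurable p) [SFinite (lam.withDensity p)]
    {g : U → E} (hg : Measurable g) :
    (α.prod (lam.withDensity p)).map (fun z => (z.1, g z.1 + z.2)) =
      (α.prod lam).withDensity (fun z => p (z.2 - g z.1)) := by
  have hm : Measurable fun z : U × E => (z.1, g z.1 + z.2) := by fun_prop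
  have hm' : Measurable fun z : U × E => p (z.2 - g z.1) := by fun_prop
  refine Measure.ext_of_lintegral _ fun f hf => ?_
  rw [lintegral_map hf hm, lintegral_withDensity_eq_lintegral_mul _ hm' hf,
    lintegral_prod (fun a : U × E => f (a.1, g a.1 + a.2)) (hf.comp hm).aemeasurable,
    lintegral_prod _ (hm'.mul hf).aemeasurable]
  refine lintegral_congr fun u => ?_
  rw [lintegral_withDensity_eq_lintegral_mul _ hp (by fun_prop)]
  refine Eq.trans ?_ (lintegral_add_left_eq_self (μ := lam)
    (fun y => p (y - g u) * f (u, y)) (g u))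
  simp

/-- Mutual information of an additive noise channel whose output law is the image of the noise
law under a linear isomorphism `L`: it is the logarithm of the volume scaling of `L`. The density
of the noise need not be known, only the integrability of its logarithm, because the entropies of
the noise and of the output differ by `log |det L|`. -/
theorem klDiv_additive_noise (α : Measure U) [IsProbabilityMeasure α]
    (lam : Measure E) [lam.IsAddHaarMeasure] {p : E → ℝ} (hp : Measurable p) (hpos : ∀ y, 0 < p y)
    (γ : Measure E) [IsProbabilityMeasure γ]
    (hγ : γ = lam.withDensity fun y => ENNReal.ofReal (p y))
    (hint : Integrable (fun y => Real.log (p y)) γ) {g : U → E} (hg : Measurable g)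
    (L : E ≃L[ℝ] E) (hL : (α.prod γ).map (fun z => g z.1 + z.2) = γ.map L) :
    klDiv ((α.prod γ).map fun z => (z.1, g z.1 + z.2)) (α.prod (γ.map L)) ≠ ∞ ∧
    (klDiv ((α.prod γ).map fun z => (z.1, g z.1 + z.2)) (α.prod (γ.map L))).toReal =
      Real.log |LinearMap.det (L : E →ₗ[ℝ] E)| := by
  have hdet : LinearMap.det (L : E →ₗ[ℝ] E) ≠ 0 := L.toLinearEquiv.isUnit_det'.ne_zero
  set d := LinearMap.det (L : E →ₗ[ℝ] E) with hd
  have hdpos : 0 < |d| := abs_pos.mpr hdet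
  have hshear : Measurable fun z : U × E => (z.1, g z.1 + z.2) := by fun_prop
  have hLm : Measurable L := L.continuous.measurable
  have hLs : Measurable L.symm := L.symm.continuous.measurable
  have : IsProbabilityMeasure (γ.map L) := Measure.isProbabilityMeasure_map hLm.aemeasurable
  set ρ := (α.prod γ).map fun z => (z.1, g z.1 + z.2) with hρ
  have : IsProbabilityMeasure ρ := Measure.isProbabilityMeasure_map hshear.aemeasurable
  -- the likelihood ratio of the joint law with respect to the product of the marginals
  let r : U × E → ℝ := fun z => p (z.2 - g z.1) * |d| / p (L.symm z.2)
  have hr : Measurable r := by fun_prop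
  have hrpos : ∀ z, 0 < r z := fun z => div_pos (mul_pos (hpos _) hdpos) (hpos _)
  have hdens : ρ = (α.prod (γ.map L)).withDensity fun z => ENNReal.ofReal (r z) := by
    have hsf : SFinite (lam.withDensity fun y => ENNReal.ofReal (p y)) := hγ ▸ inferInstance
    have hτ : γ.map L = lam.withDensity
        (fun y => ENNReal.ofReal |d⁻¹| * ENNReal.ofReal (p (L.symm y))) := by
      rw [hγ]; exact map_withDensity_continuousLinearEquiv lam (by fun_prop) L
    rw [hρ, hτ, prod_withDensity_right (by fun_prop), ← withDensity_mul _ (by fun_prop)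
      (by fun_prop), hγ, map_shear_withDensity α lam (by fun_prop) hg]
    congr 1
    ext z
    simp only [Pi.mul_apply]
    rw [← ENNReal.ofReal_mul (abs_nonneg _), ← ENNReal.ofReal_mul (mul_nonneg (abs_nonneg _)
      (hpos _).le)]
    congr 1
    simp only [r, abs_inv]
    field_simp [hdpos.ne', (hpos (L.symm z.2)).ne']
  have hac : ρ ≪ α.prod (γ.map L) := hdens ▸ withDensity_absolutelyContinuous _ _
  have hrn : ρ.rnDeriv (α.prod (γ.map L)) =ᵐ[ρ] fun z => ENNReal.ofReal (r z) := by
    refine hac.ae_le ?_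
    have := Measure.rnDeriv_withDensity (α.prod (γ.map L))
      (f := fun z => ENNReal.ofReal (r z)) (by fun_prop)
    rwa [← hdens] at this
  have hllr : llr ρ (α.prod (γ.map L)) =ᵐ[ρ] fun z =>
      Real.log (p (z.2 - g z.1)) + Real.log |d| - Real.log (p (L.symm z.2)) := by
    filter_upwards [hrn] with z hz
    rw [llr, hz, ENNReal.toReal_ofReal (hrpos z).le]
    simp only [r]
    rw [Real.log_div (mul_pos (hpos _) hdpos).ne' (hpos _).ne',
      Real.log_mul (hpos _).ne' hdpos.ne']
  have hlog : Measurable fun y => Real.log (p y) := hp.log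
  -- subtracting the signal from the output gives back the noise
  have h1 : ρ.map (fun z => z.2 - g z.1) = γ := by
    rw [hρ, Measure.map_map (by fun_prop) hshear]
    have : (fun z : U × E => z.2 - g z.1) ∘ (fun z : U × E => (z.1, g z.1 + z.2)) = Prod.snd := by
      ext z; simp
    rw [this]; simp
  -- the output has the law of the image of the noise under `L`
  have h2 : ρ.map (fun z => L.symm z.2) = γ := by
    have e : ρ.map (fun z => L.symm z.2) = (ρ.map Prod.snd).map L.symm :=
      (Measure.map_map hLs measurable_snd).symm
    have e' : ρ.map Prod.snd = γ.map L := by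
      rw [hρ, Measure.map_map measurable_snd hshear, ← hL]; rfl
    rw [e, e', Measure.map_map hLs hLm]
    simp
  have m1 : Measurable fun z : U × E => z.2 - g z.1 := by fun_prop
  have m2 : Measurable fun z : U × E => L.symm z.2 := by fun_prop
  have i1 : Integrable (fun z : U × E => Real.log (p (z.2 - g z.1))) ρ := by
    rw [← h1] at hint
    exact hint.comp_measurable m1
  have i2 : Integrable (fun z : U × E => Real.log (p (L.symm z.2))) ρ := by
    rw [← h2] at hint
    exact hint.comp_measurable m2
  have v1 : ∫ z, Real.log (p (z.2 - g z.1)) ∂ρ = ∫ y, Real.log (p y) ∂γ := by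
    conv_rhs => rw [← h1]
    exact (integral_map m1.aemeasurable hlog.aestronglyMeasurable).symm
  have v2 : ∫ z, Real.log (p (L.symm z.2)) ∂ρ = ∫ y, Real.log (p y) ∂γ := by
    conv_rhs => rw [← h2]
    exact (integral_map m2.aemeasurable hlog.aestronglyMeasurable).symm
  have i3 : Integrable (fun z : U × E => Real.log (p (z.2 - g z.1)) + Real.log |d|) ρ :=
    i1.add (integrable_const _)
  have hi : Integrable (llr ρ (α.prod (γ.map L))) ρ :=
    (i3.sub i2).congr hllr.symm
  refine ⟨klDiv_ne_top hac hi, ?_⟩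
  rw [toReal_klDiv_of_measure_eq hac (by simp), integral_congr_ae hllr,
    integral_sub i3 i2, integral_add i1 (integrable_const _), v1, v2]
  simp

end AdditiveNoise

/-! ### Density of white complex Gaussian noise -/

lemma pi_gaussianReal_eq_withDensity {ι : Type*} [Fintype ι] {v : NNReal} (hv : v ≠ 0) :
    Measure.pi (fun _ : ι => gaussianReal 0 v) = (volume : Measure (ι → ℝ)).withDensity
      fun x => ENNReal.ofReal (∏ i, gaussianPDFReal 0 v (x i)) := by
  refine Measure.pi_eq fun s hs => ?_
  rw [withDensity_apply _ (MeasurableSet.univ_pi hs), volume_pi, Measure.restrict_pi_pi,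
    ← ofReal_integral_eq_lintegral_ofReal
      (Integrable.fintype_prod fun i => (integrable_gaussianPDFReal 0 v).restrict)
      (.of_forall fun x => Finset.prod_nonneg fun i _ => gaussianPDFReal_nonneg _ _ _),
    integral_fintype_prod_eq_prod (fun i => gaussianPDFReal 0 v),
    ENNReal.ofReal_prod_of_nonneg fun i _ => integral_nonneg fun _ => gaussianPDFReal_nonneg _ _ _]
  refine Finset.prod_congr rfl fun i _ => ?_
  rw [gaussianReal_apply_eq_integral _ hv]

lemma integrable_log_prod_gaussianPDFReal {ι : Type*} [Fintype ι] {v : NNReal} (hv : v ≠ 0) :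
    Integrable (fun x : ι → ℝ => Real.log (∏ i, gaussianPDFReal 0 v (x i)))
      (Measure.pi fun _ : ι => gaussianReal 0 v) := by
  have h : ∀ x : ι → ℝ, Real.log (∏ i, gaussianPDFReal 0 v (x i))
      = ∑ i, (Real.log (Real.sqrt (2 * Real.pi * v))⁻¹ + -(x i) ^ 2 / (2 * v)) := fun x => by
    rw [Real.log_prod fun i _ => (gaussianPDFReal_pos _ _ _ hv).ne']
    refine Finset.sum_congr rfl fun i _ => ?_
    have : (v : ℝ) ≠ 0 := by exact_mod_cast hv
    rw [gaussianPDFReal, Real.log_mul _ (Real.exp_pos _).ne', Real.log_exp, sub_zero]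
    have : 0 < (v : ℝ) := lt_of_le_of_ne v.2 this.symm
    positivity
  simp_rw [h]
  refine integrable_finsetSum _ fun i _ => (integrable_const _).add ?_
  have : Integrable (fun y : ℝ => -y ^ 2 / (2 * v)) (gaussianReal 0 v) :=
    ((memLp_id_gaussianReal 2).integrable_sq.neg).div_const _
  exact integrable_comp_eval (μ := fun _ : ι => gaussianReal 0 v) (i := i) this

/-- The real linear isomorphism that assembles real and imaginary parts into complex
coordinates. -/
noncomputable def complexOfParts (J : Type*) [Fintype J] : (J ⊕ J → ℝ) ≃L[ℝ] (J → ℂ) :=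
  LinearEquiv.toContinuousLinearEquiv
    { toFun := fun x j => (x (Sum.inl j) : ℂ) + x (Sum.inr j) * Complex.I
      invFun := fun w => Sum.elim (fun j => (w j).re) (fun j => (w j).im)
      map_add' := fun x y => by ext j; simp; ring
      map_smul' := fun c x => by ext j; simp; ring
      left_inv := fun x => by ext (j | j) <;> simp
      right_inv := fun w => by ext j; simp }

lemma complexOfParts_apply {J : Type*} [Fintype J] (x : J ⊕ J → ℝ) (j : J) :
    complexOfParts J x j = (x (Sum.inl j) : ℂ) + x (Sum.inr j) * Complex.I := rfl

lemma integral_mul_pi_gaussianReal {ι : Type*} [Fintype ι] [DecidableEq ι] (v : NNReal) (i j : ι) :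
    ∫ x : ι → ℝ, x i * x j ∂(Measure.pi fun _ : ι => gaussianReal 0 v)
      = if i = j then (v : ℝ) else 0 := by
  have tr : ∀ (i : ι) (f : ℝ → ℝ), Measurable f →
      ∫ x : ι → ℝ, f (x i) ∂(Measure.pi fun _ : ι => gaussianReal 0 v)
        = ∫ y, f y ∂(gaussianReal 0 v) := fun i f hf =>
    integral_comp_eval (μ := fun _ : ι => gaussianReal 0 v) hf.aestronglyMeasurable
  split_ifs with h
  · subst h
    rw [tr i (fun y => y * y) (by fun_prop)]
    have := variance_fun_id_gaussianReal (μ := 0) (v := v)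
    rw [variance_of_integral_eq_zero (by fun_prop) (by simp)] at this
    simpa [pow_two] using this
  · have hind := (iIndepFun_pi (μ := fun _ : ι => gaussianReal 0 v) (X := fun _ y => y)
      (fun _ => by fun_prop)).indepFun h
    rw [hind.integral_fun_mul_eq_mul_integral
      (measurable_pi_apply i).aestronglyMeasurable (measurable_pi_apply j).aestronglyMeasurable,
      tr i (fun y => y) (by fun_prop)]
    simp

lemma integrable_mul_pi_gaussianReal {ι : Type*} [Fintype ι] (v : NNReal) (i j : ι) :
    Integrable (fun x : ι → ℝ => x i * x j) (Measure.pi fun _ : ι => gaussianReal 0 v) := by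
  have m : ∀ i : ι, MemLp (fun x : ι → ℝ => x i) 2 (Measure.pi fun _ : ι => gaussianReal 0 v) :=
    fun i => (memLp_id_gaussianReal 2).comp_measurePreserving
      (measurePreserving_eval (fun _ : ι => gaussianReal 0 v) i)
  exact (m i).integrable_mul (m j)

/-- White complex noise of power `2 v` has independent real and imaginary parts of variance
`v`. -/
lemma isComplexGaussian_map_complexOfParts {J : Type*} [Fintype J] [DecidableEq J] (v : NNReal) :
    IsComplexGaussian ((Measure.pi fun _ : J ⊕ J => gaussianReal 0 v).map (complexOfParts J))
      (((2 * v : ℝ) : ℂ) • 1) := by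
  set π := Measure.pi fun _ : J ⊕ J => gaussianReal 0 v with hπ
  have hG : IsGaussian π := by
    have h := (iIndepFun.hasGaussianLaw (P := π) (X := fun (i : J ⊕ J) (x : J ⊕ J → ℝ) => x i)
      (fun i => ⟨by
        have := (measurePreserving_eval (α := fun _ : J ⊕ J => ℝ)
          (fun _ => gaussianReal 0 v) i).map_eq
        change IsGaussian (Measure.map (Function.eval i)
          (Measure.pi fun _ : J ⊕ J => gaussianReal 0 v))
        rw [this]; infer_instance⟩)
      (iIndepFun_pi (μ := fun _ : J ⊕ J => gaussianReal 0 v) (X := fun _ (y : ℝ) => y)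
        fun _ => measurable_id.aemeasurable)).isGaussian_map
    simpa using h
  have hm : AEMeasurable (complexOfParts J) π :=
    (complexOfParts J).continuous.measurable.aemeasurable
  have hmul := integral_mul_pi_gaussianReal (ι := J ⊕ J) v
  have hint := integrable_mul_pi_gaussianReal (ι := J ⊕ J) v
  rw [← hπ] at hmul hint
  have hint1 : ∀ i : J ⊕ J, Integrable (fun x : J ⊕ J → ℝ => x i) π := fun i =>
    integrable_comp_eval (μ := fun _ : J ⊕ J => gaussianReal 0 v) (f := fun y : ℝ => y)
      ((memLp_id_gaussianReal 1).integrable (by norm_num))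
  have hmean : ∀ i : J ⊕ J, ∫ x : J ⊕ J → ℝ, x i ∂π = 0 := fun i => by
    rw [hπ, integral_comp_eval (μ := fun _ : J ⊕ J => gaussianReal 0 v) (f := fun y : ℝ => y)
      (by fun_prop)]
    simp
  have parts : ∀ {f g : (J ⊕ J → ℝ) → ℝ}, Integrable f π → Integrable g π →
      ∫ x, ((f x : ℂ) + (g x : ℂ) * Complex.I) ∂π
        = ((∫ x, f x ∂π : ℝ) : ℂ) + ((∫ x, g x ∂π : ℝ) : ℂ) * Complex.I := fun {f g} hf hg => by
    rw [integral_add hf.ofReal (hg.ofReal.mul_const _), integral_mul_const,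
      integral_complex_ofReal, integral_complex_ofReal]
  refine ⟨inferInstanceAs (IsGaussian (π.map (complexOfParts J))), fun j => ?_, fun j k => ?_,
    fun j k => ?_⟩
  · rw [integral_map hm (measurable_pi_apply j).aestronglyMeasurable]
    simp_rw [complexOfParts_apply]
    rw [parts (hint1 _) (hint1 _), hmean, hmean]
    simp
  · rw [integral_map hm (by fun_prop)]
    have e : ∀ x : J ⊕ J → ℝ, star (complexOfParts J x j) * complexOfParts J x k
        = ((x (.inl j) * x (.inl k) + x (.inr j) * x (.inr k) : ℝ) : ℂ)
          + ((x (.inl j) * x (.inr k) - x (.inr j) * x (.inl k) : ℝ) : ℂ) * Complex.I := by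
      intro x
      simp only [complexOfParts_apply]
      apply Complex.ext <;> simp; ring
    simp_rw [e]
    refine (parts ((hint _ _).add (hint _ _)) ((hint _ _).sub (hint _ _))).trans ?_
    simp only [Pi.add_apply, Pi.sub_apply]
    rw [integral_add (hint _ _) (hint _ _), integral_sub (hint _ _) (hint _ _)]
    simp only [hmul, Matrix.smul_apply, Matrix.one_apply]
    by_cases h : j = k
    · subst h; simp; ring
    · simp [h]
  · rw [integral_map hm (by fun_prop)]
    have e : ∀ x : J ⊕ J → ℝ, complexOfParts J x j * complexOfParts J x k
        = ((x (.inl j) * x (.inl k) - x (.inr j) * x (.inr k) : ℝ) : ℂ)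
          + ((x (.inl j) * x (.inr k) + x (.inr j) * x (.inl k) : ℝ) : ℂ) * Complex.I := by
      intro x
      simp only [complexOfParts_apply]
      apply Complex.ext <;> simp
    simp_rw [e]
    refine (parts ((hint _ _).sub (hint _ _)) ((hint _ _).add (hint _ _))).trans ?_
    simp only [Pi.add_apply, Pi.sub_apply]
    rw [integral_add (hint _ _) (hint _ _), integral_sub (hint _ _) (hint _ _)]
    simp only [hmul]
    by_cases h : j = k
    · subst h; simp
    · simp [h]

/-- White complex Gaussian noise has a positive density with respect to a Haar measure, and the
logarithm of that density is integrable. -/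
lemma IsComplexGaussian.exists_density {J : Type*} [Fintype J] [DecidableEq J] {σ : ℝ}
    (hσ : 0 < σ) {γ : Measure (J → ℂ)} (hγ : IsComplexGaussian γ (((σ ^ 2 : ℝ) : ℂ) • 1)) :
    ∃ (lam : Measure (J → ℂ)) (p : (J → ℂ) → ℝ), lam.IsAddHaarMeasure ∧ Measurable p ∧
      (∀ y, 0 < p y) ∧ γ = lam.withDensity (fun y => ENNReal.ofReal (p y)) ∧
      Integrable (fun y => Real.log (p y)) γ := by
  let v : NNReal := ⟨σ ^ 2 / 2, by positivity⟩
  have hv : v ≠ 0 := by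
    intro h
    have : (v : ℝ) = 0 := by rw [h]; rfl
    have h2 : σ ^ 2 / 2 = 0 := this
    have : 0 < σ ^ 2 / 2 := by positivity
    linarith
  set e := complexOfParts J
  have hem : Measurable e := e.continuous.measurable
  have hes : Measurable e.symm := e.symm.continuous.measurable
  have hγe : γ = (Measure.pi fun _ : J ⊕ J => gaussianReal 0 v).map e := by
    refine hγ.ext ?_
    have := isComplexGaussian_map_complexOfParts (J := J) v
    have hv2 : (2 * v : ℝ) = σ ^ 2 := by
      change 2 * (σ ^ 2 / 2) = σ ^ 2
      ring
    rwa [hv2] at this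
  let q : (J ⊕ J → ℝ) → ℝ := fun x => ∏ i, gaussianPDFReal 0 v (x i)
  have hq : Measurable q := Finset.measurable_fun_prod _ fun i _ =>
    (measurable_gaussianPDFReal 0 v).comp (measurable_pi_apply i)
  refine ⟨(volume : Measure (J ⊕ J → ℝ)).map e, fun y => q (e.symm y),
    ContinuousLinearEquiv.isAddHaarMeasure_map e _, hq.comp hes,
    fun y => Finset.prod_pos fun i _ => gaussianPDFReal_pos _ _ _ hv, ?_, ?_⟩
  · rw [hγe, pi_gaussianReal_eq_withDensity hv]
    refine Measure.ext_of_lintegral _ fun f hf => ?_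
    have h1 : Measurable fun x => ENNReal.ofReal (q x) := by fun_prop
    have h2 : Measurable fun y => ENNReal.ofReal (q (e.symm y)) := h1.comp hes
    rw [lintegral_map hf hem, lintegral_withDensity_eq_lintegral_mul _ h1
      (show Measurable fun x => f (e x) from hf.comp hem),
      lintegral_withDensity_eq_lintegral_mul _ h2 hf, lintegral_map (h2.mul hf) hem]
    simp [q]
  · have hl : Measurable fun y => Real.log (q (e.symm y)) := (hq.comp hes).log
    rw [hγe, integrable_map_measure hl.aestronglyMeasurable hem.aemeasurable]
    refine (integrable_log_prod_gaussianPDFReal (ι := J ⊕ J) hv).congr (.of_forall fun x => ?_)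
    simp [q]

/-! ### Gaussian channels with white noise -/

lemma Matrix.PosSemidef.exists_conjTranspose_mul_self {n : Type*} [Fintype n] [DecidableEq n]
    {A : Matrix n n ℂ} (hA : A.PosSemidef) : ∃ B : Matrix n n ℂ, A = Bᴴ * B := by
  open scoped MatrixOrder Matrix.Norms.L2Operator in
  exact CStarAlgebra.nonneg_iff_eq_star_mul_self.mp (Matrix.nonneg_iff_posSemidef.mpr hA)

lemma Matrix.PosSemidef.blockDiagonal {n o : Type*} [Fintype n] [DecidableEq n] [Fintype o]
    [DecidableEq o] {A : o → Matrix n n ℂ} (hA : ∀ i, (A i).PosSemidef) :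
    (Matrix.blockDiagonal A).PosSemidef := by
  choose B hB using fun i => (hA i).exists_conjTranspose_mul_self
  have : Matrix.blockDiagonal A = (Matrix.blockDiagonal B)ᴴ * Matrix.blockDiagonal B := by
    rw [Matrix.blockDiagonal_conjTranspose, ← Matrix.blockDiagonal_mul]
    exact congrArg _ (funext hB)
  rw [this]
  exact Matrix.posSemidef_conjTranspose_mul_self _

lemma posDef_add_smul_one {n : Type*} [Fintype n] [DecidableEq n] {A : Matrix n n ℂ}
    (hA : A.PosSemidef) {c : ℝ} (hc : 0 < c) : (A + ((c : ℝ) : ℂ) • (1 : Matrix n n ℂ)).PosDef :=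
  Matrix.PosDef.posSemidef_add hA (Matrix.PosDef.one.smul (by exact_mod_cast hc))

section Noise

variable {J : Type*} [Fintype J] [DecidableEq J]

/-- The real-linear isomorphism `y ↦ y A` of row vectors. -/
noncomputable def vecMulEquiv (A : Matrix J J ℂ) (hA : A.det ≠ 0) : (J → ℂ) ≃L[ℝ] (J → ℂ) :=
  LinearEquiv.toContinuousLinearEquiv
    ((LinearEquiv.ofIsUnitDet (f := Matrix.toLin' Aᵀ) (v := Pi.basisFun ℂ J)
      (v' := Pi.basisFun ℂ J) (by simpa using hA)).restrictScalars ℝ)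

lemma vecMulEquiv_apply (A : Matrix J J ℂ) (hA : A.det ≠ 0) (y : J → ℂ) :
    vecMulEquiv A hA y = y ᵥ* A := by
  change Aᵀ *ᵥ y = _
  rw [Matrix.mulVec_transpose]

lemma det_vecMulEquiv (A : Matrix J J ℂ) (hA : A.det ≠ 0) :
    LinearMap.det (vecMulEquiv A hA : (J → ℂ) →ₗ[ℝ] (J → ℂ)) = Complex.normSq A.det := by
  have : (vecMulEquiv A hA : (J → ℂ) →ₗ[ℝ] (J → ℂ))
      = (Matrix.toLin' Aᵀ).restrictScalars ℝ := rfl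
  rw [this, LinearMap.det_restrictScalars, LinearMap.det_toLin', Matrix.det_transpose,
    Algebra.norm_complex_apply]

/-- The mutual information of a channel with white complex Gaussian noise whose useful signal
`g(U)` is complex Gaussian with covariance `C`. -/
theorem mutualInfo_gaussian_channel {U : Type*} [MeasurableSpace U] (α : Measure U)
    [IsProbabilityMeasure α] {σ : ℝ} (hσ : 0 < σ) {γ : Measure (J → ℂ)}
    (hγ : IsComplexGaussian γ (((σ ^ 2 : ℝ) : ℂ) • 1)) {g : U → J → ℂ} (hg : Measurable g)
    {C : Matrix J J ℂ} (hC : IsComplexGaussian (α.map g) C) :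
    ∃ c : ℝ, 0 ≤ c ∧
      mutualInfo ((α.prod γ).map fun z => (z.1, g z.1 + z.2)) = ENNReal.ofReal c ∧
      c = Real.logb 2 (((σ ^ 2) ^ Fintype.card J)⁻¹ *
        (C + ((σ ^ 2 : ℝ) : ℂ) • (1 : Matrix J J ℂ)).det.re) := by
  have := hγ.isGaussian
  set S := C + ((σ ^ 2 : ℝ) : ℂ) • (1 : Matrix J J ℂ) with hS
  have hSpos : S.PosDef := posDef_add_smul_one hC.posSemidef (by positivity)
  obtain ⟨B, hB⟩ := hSpos.posSemidef.exists_conjTranspose_mul_self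
  set A : Matrix J J ℂ := ((σ⁻¹ : ℝ) : ℂ) • B with hA
  -- `y ↦ y A` turns the noise covariance `σ² I` into the output covariance
  have hAA : Aᴴ * (((σ ^ 2 : ℝ) : ℂ) • 1) * A = S := by
    rw [hB, hA]
    simp only [Matrix.conjTranspose_smul, Matrix.mul_smul, Matrix.smul_mul, Matrix.mul_one,
      smul_smul, Complex.star_def, Complex.conj_ofReal]
    have : ((σ⁻¹ : ℝ) : ℂ) * ((σ ^ 2 : ℝ) : ℂ) * ((σ⁻¹ : ℝ) : ℂ) = 1 := by
      rw [← Complex.ofReal_mul, ← Complex.ofReal_mul]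
      norm_cast
      field_simp
    convert one_smul ℂ (Bᴴ * B) using 2
    linear_combination this
  have hdetS : S.det = (((σ ^ 2) ^ Fintype.card J * Complex.normSq A.det : ℝ) : ℂ) := by
    rw [← hAA, Matrix.det_mul, Matrix.det_mul, Matrix.det_conjTranspose,
      Matrix.det_smul (1 : Matrix J J ℂ),
      Matrix.det_one]
    push_cast [Complex.normSq_eq_conj_mul_self]
    rw [Complex.star_def]
    ring
  have hAdet : A.det ≠ 0 := by
    intro h0
    have := hSpos.det_pos
    rw [hdetS, h0] at this
    simp at this
  let L := vecMulEquiv A hAdet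
  have hL : (α.prod γ).map (fun z => g z.1 + z.2) = γ.map L := by
    have h1 : (α.prod γ).map (fun z => g z.1 + z.2)
        = ((α.map g).prod γ).map fun z => z.1 + z.2 := by
      have : (α.map g).prod γ = (α.prod γ).map (Prod.map g id) := by
        conv_lhs => rw [← Measure.map_id (μ := γ)]
        rw [Measure.map_prod_map _ _ hg measurable_id]
      rw [this, Measure.map_map (by fun_prop) (by fun_prop)]
      rfl
    have h2 : γ.map L = γ.map fun y => y ᵥ* A :=
      congrArg (γ.map ·) (funext (vecMulEquiv_apply A hAdet))
    rw [h1, h2]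
    refine (hC.map_add_prod hγ).ext ?_
    have := hγ.map_vecMul A
    rwa [hAA] at this
  obtain ⟨lam, p, hlam, hp, hpos, hdens, hint⟩ := hγ.exists_density hσ
  obtain ⟨hne, hval⟩ := klDiv_additive_noise α lam hp hpos γ hdens hint hg L hL
  have hfst : ((α.prod γ).map fun z => (z.1, g z.1 + z.2)).fst = α := by
    rw [Measure.fst_map_prodMk (by fun_prop)]
    exact (measurePreserving_fst (μ := α) (ν := γ)).map_eq
  have hsnd : ((α.prod γ).map fun z => (z.1, g z.1 + z.2)).snd = γ.map L := by
    rw [Measure.snd_map_prodMk (by fun_prop), hL]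
  have hlog2 : 0 < Real.log 2 := Real.log_pos one_lt_two
  rw [det_vecMulEquiv, abs_of_nonneg (Complex.normSq_nonneg _)] at hval
  have hlog : Real.logb 2 (((σ ^ 2) ^ Fintype.card J)⁻¹ * S.det.re)
      = Real.log (Complex.normSq A.det) / Real.log 2 := by
    rw [hdetS, Complex.ofReal_re, inv_mul_cancel_left₀ (by positivity), Real.logb]
  refine ⟨_, ?_, ?_, rfl⟩
  · rw [hlog, ← hval]
    exact div_nonneg ENNReal.toReal_nonneg hlog2.le
  · rw [hlog, mutualInfo, hfst, hsnd, ← hval, ENNReal.ofReal_div_of_pos hlog2,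
      ENNReal.ofReal_toReal hne]

end Noise

/-! ### Second moments of the OFDM signal model -/

section Model

variable {N M NT NU : ℕ}

/-- The matrix through which the vector of all data symbols, indexed by transmit antenna, carrier,
subcarrier and symbol time, is mapped to the vector of all noiseless received symbols. -/
noncomputable def channelMatrix (M : ℕ) (h : Fin 2 → CarrierChannel N NT NU) :
    Matrix (Fin NT × (Fin 2 × Fin N × Fin M)) ((Fin M × Fin N) × Fin NU) ℂ :=
  Matrix.of fun i j =>
    if i.2.2.1 = j.1.2 then if i.2.2.2 = j.1.1 then h i.2.1 i.2.2.1 i.1 j.2 else 0 else 0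

lemma measurable_matrix_apply {m n : Type*} (i : m) (j : n) :
    Measurable fun A : Matrix m n ℂ => A i j :=
  (measurable_pi_apply j).comp (measurable_pi_apply i)

lemma measurable_matrix_iff {α m n : Type*} [MeasurableSpace α] {f : α → Matrix m n ℂ} :
    Measurable f ↔ ∀ i j, Measurable fun a => f a i j :=
  ⟨fun hf i j => (measurable_matrix_apply i j).comp hf, fun hf =>
    measurable_pi_lambda _ fun i => measurable_pi_lambda _ fun j => hf i j⟩

lemma measurable_carrier_entry {b : Fin 2} {n : Fin N} {k : Fin NT} {m : Fin M} :
    Measurable fun x : Fin 2 → CarrierData N M NT => x b n k m :=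
  (measurable_matrix_apply k m).comp ((measurable_pi_apply n).comp (measurable_pi_apply b))

lemma dataMatrix_apply (x : CarrierData N M NT) (m : Fin M) (n : Fin N) (k : Fin NT)
    (n' : Fin N) : dataMatrix x (m, n) (k, n') = if n = n' then x n k m else 0 := by
  rw [dataMatrix, Matrix.blockDiagonal_apply]; rfl

lemma measurable_dataMatrices :
    Measurable fun (x : Fin 2 → CarrierData N M NT) b => dataMatrix (x b) := by
  refine measurable_pi_lambda _ fun b => measurable_matrix_iff.mpr fun ⟨m, n⟩ ⟨k, n'⟩ => ?_
  simp_rw [dataMatrix_apply]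
  split_ifs
  · exact measurable_carrier_entry
  · exact measurable_const

lemma sum_dataMatrix_mul_stackedChannel_apply (x : Fin 2 → CarrierData N M NT)
    (h : Fin 2 → CarrierChannel N NT NU) (m : Fin M) (n : Fin N) (z : Fin NU) :
    (∑ b, dataMatrix (x b) * stackedChannel (h b)) (m, n) z
      = ∑ b, ∑ k, x b n k m * h b n k z := by
  rw [Matrix.sum_apply]
  refine Finset.sum_congr rfl fun b _ => ?_
  rw [Matrix.mul_apply, Fintype.sum_prod_type]
  refine Finset.sum_congr rfl fun k _ => ?_
  simp [dataMatrix_apply, stackedChannel]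

lemma vecMul_channelMatrix_apply (x : Fin 2 → CarrierData N M NT)
    (h : Fin 2 → CarrierChannel N NT NU) (m : Fin M) (n : Fin N) (z : Fin NU) :
    ((fun p : Fin NT × (Fin 2 × Fin N × Fin M) => x p.2.1 p.2.2.1 p.1 p.2.2.2) ᵥ*
      channelMatrix M h) ((m, n), z) = ∑ b, ∑ k, x b n k m * h b n k z := by
  simp only [Matrix.vecMul, dotProduct, channelMatrix, Matrix.of_apply, Fintype.sum_prod_type,
    mul_ite, mul_zero, Finset.sum_ite_eq', Finset.mem_univ, if_true, Finset.sum_ite_irrel,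
    Finset.sum_const_zero]
  exact Finset.sum_comm

/-- The covariance of the noiseless signal received on subcarrier `n` at one symbol time. -/
noncomputable def subcarrierCov (K : Fin 2 → Fin N → Matrix (Fin NT) (Fin NT) ℂ)
    (h : Fin 2 → CarrierChannel N NT NU) (n : Fin N) : Matrix (Fin NU) (Fin NU) ℂ :=
  ∑ b, (h b n)ᴴ * K b n * h b n

/-- Different symbol times and different subcarriers do not interact in the covariance of the
noiseless received signal. -/
lemma channelMatrix_conj (K : Fin 2 → Fin N → Matrix (Fin NT) (Fin NT) ℂ)
    (h : Fin 2 → CarrierChannel N NT NU) :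
    (channelMatrix M h)ᴴ * Matrix.blockDiagonal (fun p : Fin 2 × Fin N × Fin M => K p.1 p.2.1) *
        channelMatrix M h =
      (Matrix.blockDiagonal fun q : Fin M × Fin N => subcarrierCov K h q.2).submatrix
        (Equiv.prodComm _ _) (Equiv.prodComm _ _) := by
  ext ⟨⟨m, n⟩, z⟩ ⟨⟨m', n'⟩, z'⟩
  have h1 : ∀ (l : Fin NT) (b : Fin 2) (i : Fin N) (j : Fin M),
      ((channelMatrix M h)ᴴ * Matrix.blockDiagonal
        (fun p : Fin 2 × Fin N × Fin M => K p.1 p.2.1)) ((m, n), z) (l, (b, i, j))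
      = if i = n then if j = m then ∑ k, star (h b n k z) * K b n k l else 0 else 0 := by
    intro l b i j
    rw [Matrix.mul_apply, Fintype.sum_prod_type]
    have : ∀ k : Fin NT, ∑ p : Fin 2 × Fin N × Fin M,
        (channelMatrix M h)ᴴ ((m, n), z) (k, p) * Matrix.blockDiagonal
          (fun p : Fin 2 × Fin N × Fin M => K p.1 p.2.1) (k, p) (l, (b, i, j))
        = star (channelMatrix M h (k, (b, i, j)) ((m, n), z)) * K b i k l := fun k => by
      simp [Matrix.blockDiagonal_apply, Matrix.conjTranspose_apply]
    simp_rw [this]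
    simp only [channelMatrix, Matrix.of_apply]
    split_ifs with hi hj
    · subst hi; rfl
    · simp
    · simp
  rw [Matrix.mul_apply]
  simp only [Fintype.sum_prod_type, h1]
  simp only [channelMatrix, Matrix.of_apply, ite_mul, zero_mul, Finset.sum_ite_eq',
    Finset.mem_univ, if_true, Finset.sum_ite_irrel, Finset.sum_const_zero, mul_ite, mul_zero,
    Matrix.submatrix_apply, Equiv.prodComm_apply, Prod.swap_prod_mk, Matrix.blockDiagonal_apply,
    Prod.mk.injEq]
  by_cases hn : n = n'
  · by_cases hm : m = m'
    · subst hn hm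
      simp only [and_self, if_true, subcarrierCov, Matrix.sum_apply, Matrix.mul_apply,
        Matrix.conjTranspose_apply]
      exact Finset.sum_comm
    · simp [hm, Ne.symm hm]
  · simp [hn, Ne.symm hn]

variable {ν : Measure (Fin 2 → CarrierData N M NT)}
  {K : Fin 2 → Fin N → Matrix (Fin NT) (Fin NT) ℂ}

lemma conjTranspose_dataMatrix_mul_self_apply (x : CarrierData N M NT) (k l : Fin NT)
    (n n' : Fin N) : ((dataMatrix x)ᴴ * dataMatrix x) (k, n) (l, n')
      = if n = n' then ∑ m, star (x n k m) * x n l m else 0 := by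
  rw [dataMatrix, Matrix.blockDiagonal_conjTranspose, ← Matrix.blockDiagonal_mul,
    Matrix.blockDiagonal_apply]
  rfl

/-- Averaging over the `M` symbol times cancels the normalisation by `M`. -/
lemma inputCov_eq (hM : M ≠ 0) (hK : ∀ (b : Fin 2) (n : Fin N) (m : Fin M),
      IsComplexGaussian (ν.map fun x (k : Fin NT) => x b n k m) (K b n)) (b : Fin 2) :
    inputCov ν b = Matrix.blockDiagonal (K b) := by
  have hmeas : ∀ (n : Fin N) (m : Fin M),
      Measurable fun (x : Fin 2 → CarrierData N M NT) (k : Fin NT) => x b n k m := fun n m =>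
    measurable_pi_lambda _ fun k => measurable_carrier_entry
  ext ⟨k, n⟩ ⟨l, n'⟩
  rw [Matrix.blockDiagonal_apply, inputCov, Matrix.of_apply]
  simp_rw [conjTranspose_dataMatrix_mul_self_apply]
  split_ifs with h
  · subst h
    have hi : ∀ m : Fin M, Integrable (fun x => star (x b n k m) * x b n l m) ν := fun m =>
      ((hK b n m).integrable_star_mul k l).comp_measurable (hmeas n m)
    rw [integral_div, integral_finsetSum _ fun m _ => hi m]
    have : ∀ m : Fin M, ∫ x, star (x b n k m) * x b n l m ∂ν = K b n k l := fun m => by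
      rw [← (hK b n m).cov_eq, integral_map (hmeas n m).aemeasurable (by fun_prop)]
    simp_rw [this]
    have : (M : ℂ) ≠ 0 := by exact_mod_cast hM
    simp
    field_simp
  · simp

/-- Without symbol times the normalised input covariance is an empty sum divided by `0`, that
is `0`. -/
lemma inputCov_of_eq_zero (hM : M = 0) (b : Fin 2) : inputCov ν b = 0 := by
  subst hM
  ext ⟨k, n⟩ ⟨l, n'⟩
  simp [inputCov]

lemma outputCov_eq (hM : M ≠ 0) (hK : ∀ (b : Fin 2) (n : Fin N) (m : Fin M),
      IsComplexGaussian (ν.map fun x (k : Fin NT) => x b n k m) (K b n)) (σ : ℝ)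
    (h : Fin 2 → CarrierChannel N NT NU) :
    outputCov σ ν h = Matrix.blockDiagonal fun n =>
      subcarrierCov K h n + ((σ ^ 2 : ℝ) : ℂ) • (1 : Matrix (Fin NU) (Fin NU) ℂ) := by
  have hb : ∀ b, (diagChannel (h b))ᴴ * inputCov ν b * diagChannel (h b)
      = Matrix.blockDiagonal fun n => (h b n)ᴴ * K b n * h b n := fun b => by
    rw [inputCov_eq hM hK, diagChannel, Matrix.blockDiagonal_conjTranspose,
      ← Matrix.blockDiagonal_mul, ← Matrix.blockDiagonal_mul]
  ext ⟨z, n⟩ ⟨z', n'⟩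
  simp only [outputCov, hb, subcarrierCov]
  by_cases hn : n = n'
  · subst hn
    simp [-Matrix.blockDiagonal_mul, Matrix.add_apply, Matrix.blockDiagonal_apply,
      Matrix.one_apply]
  · simp [-Matrix.blockDiagonal_mul, Matrix.add_apply, Matrix.blockDiagonal_apply, hn]

lemma posDef_outputCov (hν : IsGaussianSignalling ν) {σ : ℝ} (hσ : 0 < σ)
    (h : Fin 2 → CarrierChannel N NT NU) : (outputCov σ ν h).PosDef := by
  obtain ⟨-, K, hK⟩ := hν
  have hin : ∀ b, (inputCov ν b).PosSemidef := fun b => by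
    -- no row is available to recognise `K b n` as a covariance when `M = 0`
    rcases Nat.eq_zero_or_pos M with hM | hM
    · rw [inputCov_of_eq_zero hM]; exact Matrix.PosSemidef.zero
    · rw [inputCov_eq hM.ne' hK]
      exact Matrix.PosSemidef.blockDiagonal fun n => (hK b n ⟨0, hM⟩).posSemidef
  exact posDef_add_smul_one (Matrix.posSemidef_sum _ fun b _ =>
    (hin b).conjTranspose_mul_mul_same _) (by positivity)

/-- The rows received at different times have the same covariance, so that the covariance of the
whole received signal has determinant `(det (outputCov σ ν h)) ^ M`. -/
lemma det_receivedCov (hK : ∀ (b : Fin 2) (n : Fin N) (m : Fin M),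
      IsComplexGaussian (ν.map fun x (k : Fin NT) => x b n k m) (K b n)) (σ : ℝ)
    (h : Fin 2 → CarrierChannel N NT NU) :
    ((channelMatrix M h)ᴴ * Matrix.blockDiagonal (fun p : Fin 2 × Fin N × Fin M => K p.1 p.2.1) *
        channelMatrix M h + ((σ ^ 2 : ℝ) : ℂ) • 1).det = (outputCov σ ν h).det ^ M := by
  have e : (channelMatrix M h)ᴴ *
        Matrix.blockDiagonal (fun p : Fin 2 × Fin N × Fin M => K p.1 p.2.1) *
        channelMatrix M h + ((σ ^ 2 : ℝ) : ℂ) • 1 =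
      (Matrix.blockDiagonal fun q : Fin M × Fin N => subcarrierCov K h q.2 +
        ((σ ^ 2 : ℝ) : ℂ) • (1 : Matrix (Fin NU) (Fin NU) ℂ)).submatrix
        (Equiv.prodComm _ _) (Equiv.prodComm _ _) := by
    rw [channelMatrix_conj]
    ext ⟨q, z⟩ ⟨q', z'⟩
    by_cases hq : q = q'
    · subst hq
      simp [Matrix.add_apply, Matrix.blockDiagonal_apply, Matrix.one_apply]
    · simp [Matrix.add_apply, Matrix.blockDiagonal_apply, hq]
  rw [e, Matrix.det_submatrix_equiv_self, Matrix.det_blockDiagonal, Fintype.prod_prod_type]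
  rcases eq_or_ne M 0 with hM | hM
  -- both sides are `1`, whatever `outputCov` is
  · subst hM; simp
  · rw [outputCov_eq hM hK, Matrix.det_blockDiagonal]
    simp

end Model

/-! ### The channel for a fixed realization, and conditioning on it -/

section FixedChannel

variable {N M NT NU : ℕ}

/-- A matrix as the vector of its entries, indexed by the pairs of a row and a column. -/
def matrixVec (m n : Type*) : Matrix m n ℂ ≃ᵐ (m × n → ℂ) where
  toFun w p := w p.1 p.2
  invFun v := Matrix.of fun i j => v (i, j)
  left_inv _ := rfl
  right_inv _ := rfl
  measurable_toFun := measurable_pi_lambda _ fun p => measurable_matrix_apply p.1 p.2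
  measurable_invFun := measurable_matrix_iff.mpr fun i j => measurable_pi_apply (i, j)

lemma det_re_pow {n : Type*} [Fintype n] [DecidableEq n] {A : Matrix n n ℂ} (hA : A.PosDef)
    (k : ℕ) : (A.det ^ k).re = A.det.re ^ k := by
  have : A.det = ((A.det.re : ℝ) : ℂ) :=
    Complex.ext rfl (by simpa using (Complex.lt_def.mp hA.det_pos).2.symm)
  rw [this, ← Complex.ofReal_pow, Complex.ofReal_re, Complex.ofReal_re]

/-- The noiseless received signal of Gaussian data is complex Gaussian. -/
lemma isComplexGaussian_noiseless {ν : Measure (Fin 2 → CarrierData N M NT)}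
    {K : Fin 2 → Fin N → Matrix (Fin NT) (Fin NT) ℂ}
    (hind : iIndepFun (fun (p : Fin 2 × Fin N × Fin M) (x : Fin 2 → CarrierData N M NT)
      (k : Fin NT) => x p.1 p.2.1 k p.2.2) ν)
    (hK : ∀ (b : Fin 2) (n : Fin N) (m : Fin M),
      IsComplexGaussian (ν.map fun x (k : Fin NT) => x b n k m) (K b n))
    (h : Fin 2 → CarrierChannel N NT NU) :
    IsComplexGaussian
      (ν.map fun x => matrixVec (Fin M × Fin N) (Fin NU)
        (∑ b, dataMatrix (x b) * stackedChannel (h b)))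
      ((channelMatrix M h)ᴴ *
        Matrix.blockDiagonal (fun p : Fin 2 × Fin N × Fin M => K p.1 p.2.1) *
        channelMatrix M h) := by
  have hrow : ∀ p : Fin 2 × Fin N × Fin M, Measurable fun (x : Fin 2 → CarrierData N M NT)
      (k : Fin NT) => x p.1 p.2.1 k p.2.2 := fun p =>
    measurable_pi_lambda _ fun k => measurable_carrier_entry
  have hvec : Measurable fun (x : Fin 2 → CarrierData N M NT)
      (p : Fin NT × (Fin 2 × Fin N × Fin M)) => x p.2.1 p.2.2.1 p.1 p.2.2.2 :=
    measurable_pi_lambda _ fun p => measurable_carrier_entry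
  have := (IsComplexGaussian.of_iIndepFun hrow hind fun p => hK p.1 p.2.1 p.2.2).map_vecMul
    (channelMatrix M h)
  rw [Measure.map_map (by fun_prop) hvec] at this
  convert this using 2
  ext x ⟨⟨m, n⟩, z⟩
  exact (sum_dataMatrix_mul_stackedChannel_apply x h m n z).trans
    (vecMul_channelMatrix_apply x h m n z).symm

lemma measurable_sum_mul_stackedChannel (h : Fin 2 → CarrierChannel N NT NU) :
    Measurable fun u : Fin 2 → Matrix (Fin M × Fin N) (Fin NT × Fin N) ℂ =>
      ∑ b, u b * stackedChannel (h b) := by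
  refine measurable_matrix_iff.mpr fun i j => ?_
  simp_rw [Matrix.sum_apply, Matrix.mul_apply]
  exact Finset.measurable_fun_sum _ fun b _ => Finset.measurable_fun_sum _ fun k _ =>
    ((measurable_matrix_apply i k).comp (measurable_pi_apply b)).mul_const _

/-- The mutual information for a known channel `h`, when the data have law `ν` and the noise has
law `γ`. -/
theorem mutualInfo_received {ν : Measure (Fin 2 → CarrierData N M NT)}
    (hν : IsGaussianSignalling ν) {σ : ℝ} (hσ : 0 < σ)
    {γ : Measure (Matrix (Fin M × Fin N) (Fin NU) ℂ)}
    (hγ : IsComplexGaussian (γ.map fun w (p : (Fin M × Fin N) × Fin NU) => w p.1 p.2)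
      (((σ ^ 2 : ℝ) : ℂ) • 1)) (h : Fin 2 → CarrierChannel N NT NU) :
    ((mutualInfo ((ν.prod γ).map fun z =>
      (fun b => dataMatrix (z.1 b), received z.1 h z.2)) : ℝ≥0∞) : EReal)
      = ((closedFormMI σ ν h : ℝ) : EReal) := by
  have hpos := posDef_outputCov hν hσ h
  obtain ⟨hind, K, hK⟩ := hν
  have hνP := hind.isProbabilityMeasure
  have hmW : Measurable (matrixVec (Fin M × Fin N) (Fin NU)) := MeasurableEquiv.measurable _
  have hγP : IsProbabilityMeasure γ := by
    have := hγ.isGaussian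
    have : IsProbabilityMeasure (γ.map (matrixVec (Fin M × Fin N) (Fin NU))) :=
      inferInstanceAs (IsProbabilityMeasure
        (γ.map fun w (p : (Fin M × Fin N) × Fin NU) => w p.1 p.2))
    exact Measure.isProbabilityMeasure_of_map (matrixVec (Fin M × Fin N) (Fin NU))
  set A : (Fin 2 → CarrierData N M NT) → Fin 2 → Matrix (Fin M × Fin N) (Fin NT × Fin N) ℂ :=
    fun x b => dataMatrix (x b) with hA
  have hAm : Measurable A := measurable_dataMatrices
  have hαP : IsProbabilityMeasure (ν.map A) := Measure.isProbabilityMeasure_map hAm.aemeasurable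
  set e := matrixVec (Fin M × Fin N) (Fin NU) with he
  let g : (Fin 2 → Matrix (Fin M × Fin N) (Fin NT × Fin N) ℂ) → (Fin M × Fin N) × Fin NU → ℂ :=
    fun u => e (∑ b, u b * stackedChannel (h b))
  have hg : Measurable g := hmW.comp (measurable_sum_mul_stackedChannel h)
  have hrec : Measurable fun z : (Fin 2 → CarrierData N M NT) ×
      Matrix (Fin M × Fin N) (Fin NU) ℂ => (A z.1, received z.1 h z.2) := by
    have : Measurable fun z : (Fin 2 → CarrierData N M NT) × Matrix (Fin M × Fin N) (Fin NU) ℂ =>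
        e.symm (g (A z.1) + e z.2) := by fun_prop
    exact (hAm.comp measurable_fst).prodMk this
  have hgauss := isComplexGaussian_noiseless hind hK h
  have hgA : ν.map (fun x => matrixVec (Fin M × Fin N) (Fin NU)
      (∑ b, dataMatrix (x b) * stackedChannel (h b))) = (ν.map A).map g :=
    (Measure.map_map hg hAm).symm
  rw [hgA] at hgauss
  obtain ⟨c, hc0, hc, hcval⟩ := mutualInfo_gaussian_channel (ν.map A) hσ hγ hg hgauss
  have hmap : ((ν.map A).prod (γ.map e)).map (fun z => (z.1, g z.1 + z.2))
      = ((ν.prod γ).map fun z => (A z.1, received z.1 h z.2)).map fun z => (z.1, e z.2) := by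
    rw [Measure.map_prod_map _ _ hAm hmW, Measure.map_map (by fun_prop) (by fun_prop),
      Measure.map_map (by fun_prop) hrec]
    rfl
  have hcl : c = closedFormMI σ ν h := by
    rw [hcval, det_receivedCov hK, det_re_pow hpos, closedFormMI, ← Real.logb_pow, mul_pow]
    congr 2
    simp only [Fintype.card_prod, Fintype.card_fin, zpow_neg, zpow_natCast, inv_pow, ← pow_mul]
    ring_nf
  rw [← mutualInfo_map_right _ e, ← hmap]
  refine (congrArg _ hc).trans ?_
  rw [EReal.coe_ennreal_ofReal, max_eq_left hc0, hcl]

end FixedChannel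

section Conditioning

/-- If the noise `W` is independent of `(X, H)`, then given `H = h` the pair `(X, W)` has the
product of the conditional law of `X` and the law of `W`. -/
lemma condDistrib_noise_ae_eq {Ω α β γ δ : Type*} [MeasurableSpace Ω] [MeasurableSpace α]
    [StandardBorelSpace α] [Nonempty α] [MeasurableSpace β] [MeasurableSpace γ]
    [MeasurableSpace δ] [StandardBorelSpace δ] [Nonempty δ]
    {P : Measure Ω} [IsProbabilityMeasure P] {X : Ω → α} {H : Ω → β} {W : Ω → γ}
    (hX : Measurable X) (hH : Measurable H) (hW : Measurable W)
    (hind : IndepFun W (fun ω => (X ω, H ω)) P) {F : β × α × γ → δ} (hF : Measurable F) :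
    ∀ᵐ h ∂(P.map H), condDistrib (fun ω => F (H ω, X ω, W ω)) H P h =
      ((condDistrib X H P h).prod (P.map W)).map fun z => F (h, z) := by
  have hWP : IsProbabilityMeasure (P.map W) := Measure.isProbabilityMeasure_map hW.aemeasurable
  have hFm : Measurable fun ω => F (H ω, X ω, W ω) := by fun_prop
  -- keep the value of `H`, draw the data and the noise independently, and apply `F`
  let κ : Kernel β δ :=
    (Kernel.id ×ₖ (condDistrib X H P ×ₖ Kernel.const β (P.map W))).map F
  have hκ : ∀ h, κ h = ((condDistrib X H P h).prod (P.map W)).map fun z => F (h, z) := fun h => by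
    rw [Kernel.map_apply _ hF, Kernel.prod_apply, Kernel.prod_apply, Kernel.id_apply,
      Kernel.const_apply, Measure.dirac_prod, Measure.map_map hF (by fun_prop)]
    rfl
  have hκM : IsMarkovKernel κ := Kernel.IsMarkovKernel.map _ hF
  have key : condDistrib (fun ω => F (H ω, X ω, W ω)) H P =ᵐ[P.map H] κ := by
    refine condDistrib_ae_eq_of_measure_eq_compProd H hFm.aemeasurable ?_
    refine Measure.ext_of_lintegral _ fun f hf => ?_
    have hjoint : P.map (fun ω => (W ω, (X ω, H ω))) =
        (P.map W).prod (P.map fun ω => (X ω, H ω)) :=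
      (indepFun_iff_map_prod_eq_prod_map_map hW.aemeasurable (by fun_prop)).mp hind
    have hcd : (P.map H) ⊗ₘ condDistrib X H P = P.map fun ω => (H ω, X ω) :=
      compProd_map_condDistrib hX.aemeasurable
    have hG : Measurable fun q : γ × α × β => f (q.2.2, F (q.2.2, q.2.1, q.1)) := by fun_prop
    calc ∫⁻ a, f a ∂(P.map fun ω => (H ω, F (H ω, X ω, W ω)))
        = ∫⁻ q, f (q.2.2, F (q.2.2, q.2.1, q.1)) ∂(P.map fun ω => (W ω, (X ω, H ω))) := by
          rw [lintegral_map hf (by fun_prop), lintegral_map hG (by fun_prop)]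
      _ = ∫⁻ r, ∫⁻ w, f (r.2, F (r.2, r.1, w)) ∂(P.map W) ∂(P.map fun ω => (X ω, H ω)) := by
          rw [hjoint, lintegral_prod_symm' _ hG]
      _ = ∫⁻ r, ∫⁻ w, f (r.1, F (r.1, r.2, w)) ∂(P.map W) ∂(P.map fun ω => (H ω, X ω)) := by
          rw [lintegral_map (Measurable.lintegral_prod_right' (f := fun q : (α × β) × γ =>
            f (q.1.2, F (q.1.2, q.1.1, q.2))) (by fun_prop)) (by fun_prop),
            lintegral_map (Measurable.lintegral_prod_right' (f := fun q : (β × α) × γ =>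
            f (q.1.1, F (q.1.1, q.1.2, q.2))) (by fun_prop)) (by fun_prop)]
      _ = ∫⁻ h, ∫⁻ x, ∫⁻ w, f (h, F (h, x, w)) ∂(P.map W) ∂(condDistrib X H P h) ∂(P.map H) := by
          rw [← hcd, Measure.lintegral_compProd (Measurable.lintegral_prod_right'
            (f := fun q : (β × α) × γ => f (q.1.1, F (q.1.1, q.1.2, q.2))) (by fun_prop))]
      _ = ∫⁻ a, f a ∂(P.map H ⊗ₘ κ) := by
          rw [Measure.lintegral_compProd hf]
          refine lintegral_congr fun h => ?_
          rw [hκ, lintegral_map (by fun_prop) (by fun_prop), lintegral_prod _ (by fun_prop)]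
  filter_upwards [key] with h hh
  rw [hh, hκ]

lemma condDistrib_ae_eq_of_indepFun {Ω α β : Type*} [MeasurableSpace Ω] [MeasurableSpace α]
    [StandardBorelSpace α] [Nonempty α] [MeasurableSpace β] {P : Measure Ω}
    [IsProbabilityMeasure P] {X : Ω → α} {H : Ω → β} (hX : Measurable X) (hH : Measurable H)
    (hind : IndepFun X H P) : ∀ᵐ h ∂(P.map H), condDistrib X H P h = P.map X := by
  have key : condDistrib X H P =ᵐ[P.map H] Kernel.const β (P.map X) := by
    refine condDistrib_ae_eq_of_measure_eq_compProd H hX.aemeasurable ?_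
    rw [Measure.compProd_const]
    exact (indepFun_iff_map_prod_eq_prod_map_map hH.aemeasurable hX.aemeasurable).mp hind.symm
  filter_upwards [key] with h hh
  rw [hh, Kernel.const_apply]

end Conditioning

lemma measurable_received {N M NT NU : ℕ} :
    Measurable fun z : (Fin 2 → CarrierChannel N NT NU) × (Fin 2 → CarrierData N M NT) ×
      Matrix (Fin M × Fin N) (Fin NU) ℂ => received z.2.1 z.1 z.2.2 := by
  refine measurable_matrix_iff.mpr fun ⟨m, n⟩ j => ?_
  simp_rw [received, Matrix.add_apply, sum_dataMatrix_mul_stackedChannel_apply]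
  refine (Finset.measurable_fun_sum _ fun b _ => Finset.measurable_fun_sum _ fun k _ => ?_).add
    ((measurable_matrix_apply (m, n) j).comp (by fun_prop))
  exact (measurable_carrier_entry.comp (by fun_prop)).mul
    (measurable_carrier_entry.comp measurable_fst)

/-! ### The conditional mutual information -/

theorem theorem2 {Ω : Type*} [MeasurableSpace Ω] (P : Measure Ω) [IsProbabilityMeasure P]
    (N M NT NU : ℕ) (σ : ℝ) (hσ : 0 < σ)
    (X : Ω → Fin 2 → CarrierData N M NT)
    (H : Ω → Fin 2 → CarrierChannel N NT NU)
    (W Y : Ω → Matrix (Fin M × Fin N) (Fin NU) ℂ)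
    (hX : Measurable X) (hH : Measurable H) (hW : Measurable W)
    (hY : ∀ ω, Y ω = received (X ω) (H ω) (W ω))
    -- white Gaussian noise, independent of the data and of the channel
    (hWlaw : IsComplexGaussian
      (P.map fun ω (p : (Fin M × Fin N) × Fin NU) => W ω p.1 p.2) (((σ ^ 2 : ℝ) : ℂ) • 1))
    (hWind : IndepFun W (fun ω => (X ω, H ω)) P)
    -- given the channel, the data are Gaussian
    (hXlaw : ∀ᵐ h ∂(P.map H), IsGaussianSignalling (condDistrib X H P h)) :
    -- the mutual information for almost every realization of the known channel
    (∀ᵐ h ∂(P.map H),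
      (outputCov σ (condDistrib X H P h) h).PosDef ∧
      ((condMutualInfoAt P (fun ω b => dataMatrix (X ω b)) Y H h : ℝ≥0∞) : EReal) =
        ((closedFormMI σ (condDistrib X H P h) h : ℝ) : EReal)) ∧
    -- the mutual information averaged over the channel
    condMutualInfo P (fun ω b => dataMatrix (X ω b)) Y H =
      ∫⁻ h, ENNReal.ofReal (closedFormMI σ (condDistrib X H P h) h) ∂(P.map H) ∧
    -- data independent of the channel: the expectation is unconditional
    (IndepFun X H P →
      (∀ᵐ h ∂(P.map H),
        (outputCov σ (P.map X) h).PosDef ∧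
        ((condMutualInfoAt P (fun ω b => dataMatrix (X ω b)) Y H h : ℝ≥0∞) : EReal) =
          ((closedFormMI σ (P.map X) h : ℝ) : EReal)) ∧
      condMutualInfo P (fun ω b => dataMatrix (X ω b)) Y H =
        ∫⁻ h, ENNReal.ofReal (closedFormMI σ (P.map X) h) ∂(P.map H)) := by
  have hA : Measurable fun (x : Fin 2 → CarrierData N M NT) b => dataMatrix (x b) :=
    measurable_dataMatrices
  have hYeq : Y = fun ω => received (X ω) (H ω) (W ω) := funext hY
  have hlaw := condDistrib_noise_ae_eq hX hH hW hWind
    (F := fun z : (Fin 2 → CarrierChannel N NT NU) × (Fin 2 → CarrierData N M NT) ×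
      Matrix (Fin M × Fin N) (Fin NU) ℂ =>
        ((fun b => dataMatrix (z.2.1 b)), received z.2.1 z.1 z.2.2))
    ((hA.comp (by fun_prop)).prodMk measurable_received)
  have hγ : IsComplexGaussian
      ((P.map W).map fun w (p : (Fin M × Fin N) × Fin NU) => w p.1 p.2)
      (((σ ^ 2 : ℝ) : ℂ) • 1) := by
    have hmap : (P.map W).map (matrixVec (Fin M × Fin N) (Fin NU))
        = P.map fun ω (p : (Fin M × Fin N) × Fin NU) => W ω p.1 p.2 :=
      Measure.map_map (matrixVec (Fin M × Fin N) (Fin NU)).measurable hW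
    rw [← hmap] at hWlaw
    exact hWlaw
  have hpt : ∀ᵐ h ∂(P.map H),
      (outputCov σ (condDistrib X H P h) h).PosDef ∧
      ((condMutualInfoAt P (fun ω b => dataMatrix (X ω b)) Y H h : ℝ≥0∞) : EReal) =
        ((closedFormMI σ (condDistrib X H P h) h : ℝ) : EReal) := by
    filter_upwards [hlaw, hXlaw] with h hh hν
    refine ⟨posDef_outputCov hν hσ h, ?_⟩
    rw [condMutualInfoAt, hYeq, hh]
    exact mutualInfo_received hν hσ hγ h
  have toENNReal : ∀ {a : ℝ≥0∞} {c : ℝ}, (a : EReal) = (c : EReal) → a = ENNReal.ofReal c := by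
    intro a c hac
    rw [← EReal.toENNReal_coe (x := a), hac, EReal.toENNReal_of_ne_top (EReal.coe_ne_top c),
      EReal.toReal_coe]
  have havg : condMutualInfo P (fun ω b => dataMatrix (X ω b)) Y H =
      ∫⁻ h, ENNReal.ofReal (closedFormMI σ (condDistrib X H P h) h) ∂(P.map H) :=
    lintegral_congr_ae (hpt.mono fun h hh => toENNReal hh.2)
  refine ⟨hpt, havg, fun hXH => ?_⟩
  have hconst := condDistrib_ae_eq_of_indepFun hX hH hXH
  refine ⟨?_, havg.trans (lintegral_congr_ae ?_)⟩
  · filter_upwards [hpt, hconst] with h hh hc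
    rwa [hc] at hh
  · filter_upwards [hconst] with h hc
    rw [hc]
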